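/- **Proposition 2.2.** All graphs are finite, simple and undirected. For a connected graph $H$ let $m_H$ be its number of edges, $\mathbf d_H$ its vector of vertex degrees, and $R_H=[r^H_{i,j}]$ its effective resistance matrix, $r^H_{i,j}=(\mathbf e_i-\mathbf e_j)^T L_H^\dagger(\mathbf e_i-\mathbf e_j)$, where $L_H^\dagger$ is the Moore–Penrose inverse of the Laplacian matrix of $H$. Let $\kappa(H)$ be Kemeny's constant of the simple random walk on $H$, that is, $\kappa(H)=\sum_{i}\sum_{j\ne i}\pi_i m_{i,j}\pi_j$, where $\pi$ is the stationary distribution of the walk and $m_{i,j}$ is the mean first passage time from $i$ to $j$ (so $\kappa(H)=0$, an empty sum, if $H$ has a single vertex). Let $G$ be a connected graph, and let $e$ be a bridge in $G$. Let $G_1$ and $G_2$ be the connected components of $G\setminus e$, and let $e=v_1\sim v_2$ with $v_1\in V(G_1)$ and $v_2\in V(G_2)$. Then $$\kappa(G)=\frac{m_{G_1}}{m_G}\kappa(G_1)+\frac{m_{G_2}}{m_G}\kappa(G_2)+\frac{m_{G_2}+1}{m_G}\,\mathbf d_{G_1}^TR_{G_1}\mathbf e_{v_1}+\frac{m_{G_1}+1}{m_G}\,\mathbf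 d_{G_2}^TR_{G_2}\mathbf e_{v_2}+\frac{(2m_{G_1}+1)(2m_{G_2}+1)}{2m_G}.$$ -/

import Mathlib

open scoped Matrix

namespace KemenyBridge

section MarkovChain

variable {V : Type*} [Fintype V]

/-- `p` is a stationary probability vector of the transition matrix `P`: nonnegative entries that
sum to `1`, and `pᵀ P = pᵀ`. -/
def IsStationary (P : Matrix V V ℝ) (p : V → ℝ) : Prop :=
  (∀ i, 0 ≤ p i) ∧ ∑ i, p i = 1 ∧ p ᵥ* P = p

open Classical in
/-- The stationary distribution of `P` (it is unique when `P` is irreducible). The value is `0`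
if there is none; for the random walk on a connected graph this happens only on one vertex. -/
noncomputable def stationary (P : Matrix V V ℝ) : V → ℝ :=
  if h : ∃ p : V → ℝ, IsStationary P p then h.choose else 0

open Classical in
/-- The probability that the chain with transition matrix `P`, started at `i`, visits the state `j`
for the first time at time `t`, by conditioning on the first step. -/
noncomputable def firstPassageProb (P : Matrix V V ℝ) (j : V) : ℕ → V → ℝ
  | 0, i => if i = j then 1 else 0
  | t + 1, i => if i = j then 0 else ∑ k, P i k * firstPassageProb P j t k

/-- The mean first passage time from `i` to `j`: the expected value `∑ t, t * ℙ(T = t)` of the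
first time `T` at which the chain started at `i` is at `j`. (For an irreducible chain on finitely
many states, `T` is almost surely finite and the series converges.) -/
noncomputable def meanFirstPassage (P : Matrix V V ℝ) (i j : V) : ℝ :=
  ∑' t : ℕ, (t : ℝ) * firstPassageProb P j t i

open Classical in
/-- Kemeny's constant of the chain with transition matrix `P`: the sum of `π_i m_{ij} π_j` over all
`i` and all `j ≠ i`, with `π` the stationary distribution and `m` the mean first passage times. -/
noncomputable def kemenyConstant (P : Matrix V V ℝ) : ℝ :=
  ∑ i, ∑ j ∈ Finset.univ.filter (fun j => j ≠ i),
    stationary P i * meanFirstPassage P i j * stationary P j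

/-- `X` is the Moore–Penrose inverse of the real matrix `A` (the four Penrose equations, which
have exactly one solution). -/
def IsMoorePenrose (A X : Matrix V V ℝ) : Prop :=
  A * X * A = A ∧ X * A * X = X ∧ (A * X)ᵀ = A * X ∧ (X * A)ᵀ = X * A

open Classical in
/-- The Moore–Penrose inverse of a real square matrix. -/
noncomputable def pinv (A : Matrix V V ℝ) : Matrix V V ℝ :=
  if h : ∃ X : Matrix V V ℝ, IsMoorePenrose A X then h.choose else 0

end MarkovChain

section Graph

variable {V : Type*} [Fintype V]

/-- The number `m_G` of edges of `G`, as a real number. -/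
noncomputable def numEdges (G : SimpleGraph V) : ℝ := (G.edgeSet.ncard : ℝ)

open Classical in
/-- The degree vector `d_G`. -/
noncomputable def degVec (G : SimpleGraph V) : V → ℝ := fun v => (G.degree v : ℝ)

open Classical in
/-- The transition matrix of the simple random walk on `G`. -/
noncomputable def walkMatrix (G : SimpleGraph V) : Matrix V V ℝ :=
  fun u v => if G.Adj u v then 1 / (G.degree u : ℝ) else 0

/-- Kemeny's constant `κ(G)` of the simple random walk on `G`. -/
noncomputable def kappa (G : SimpleGraph V) : ℝ := kemenyConstant (walkMatrix G)

open Classical in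
/-- The effective resistance matrix `R_G`, with entries
`r_{ij} = (e_i - e_j)ᵀ L† (e_i - e_j)`, where `L` is the Laplacian matrix of `G`. -/
noncomputable def resistanceMatrix (G : SimpleGraph V) : Matrix V V ℝ :=
  fun i j => ((Pi.single i 1 - Pi.single j 1 : V → ℝ)) ⬝ᵥ
    (pinv (G.lapMatrix ℝ) *ᵥ (Pi.single i 1 - Pi.single j 1 : V → ℝ))

end Graph

end KemenyBridge

namespace KemenyBridge

/-! Everything reduces to the identity `4 m κ = dᵀ R d` for a connected graph
(`numEdges_mul_kappa`). It follows from `π = d / 2m` and the commute time identity `m_ij + m_ji = 2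
m r_ij`, because the weight `π_i π_j` is symmetric.

Across a bridge the form `dᵀ R d` splits. Resistances within a side are those of the side, a
resistance between sides is `r(a, v) + 1 + r(w, b)`, and the degree vector of each side gains one
unit at its end of the bridge. Expanding the four blocks gives the formula.

Resistances are never computed from the pseudoinverse: any potential `f` with `L f = e_i - e_j`
gives `r_ij = f i - f j` (`resistanceMatrix_eq_of_laplacian_eq`). Mean first passage times, defined
as series, are identified with solutions of the first-step equations (`meanFirstPassage_eq`), so
they too become a Laplacian problem. -/

theorem exists_isMoorePenrose_of_isHermitian {V : Type*} [Fintype V] {A : Matrix V V ℝ}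
    (hA : A.IsHermitian) : ∃ X : Matrix V V ℝ, IsMoorePenrose A X := by
  classical
  set φ := Unitary.conjStarAlgAut ℝ _ hA.eigenvectorUnitary
  set D : Matrix V V ℝ := Matrix.diagonal hA.eigenvalues
  -- With `0⁻¹ = 0`, the identity `λ * λ⁻¹ * λ = λ` also holds on the kernel.
  set E : Matrix V V ℝ := Matrix.diagonal fun i => (hA.eigenvalues i)⁻¹
  have hφ : A = φ D := hA.spectral_theorem
  have hDE : D * E = E * D := by
    simp only [D, E, Matrix.diagonal_mul_diagonal, mul_comm]
  have hsymm : ∀ B : Matrix V V ℝ, Bᵀ = star B := fun B => by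
    rw [Matrix.star_eq_conjTranspose, Matrix.conjTranspose_eq_transpose_of_trivial]
  have hstar : star (D * E) = D * E := by
    simp [D, E, Matrix.star_eq_conjTranspose, Matrix.diagonal_mul_diagonal]
  refine ⟨φ E, ?_, ?_, ?_, ?_⟩
  · rw [hφ, ← map_mul, ← map_mul]
    congr 1
    simp only [D, E, Matrix.diagonal_mul_diagonal]
    congr 1; ext i; exact mul_inv_mul_cancel _
  · rw [hφ, ← map_mul, ← map_mul]
    congr 1
    simp only [D, E, Matrix.diagonal_mul_diagonal]
    congr 1; ext i; simpa using mul_inv_mul_cancel (hA.eigenvalues i)⁻¹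
  · rw [hφ, ← map_mul, hsymm, ← map_star, hstar]
  · rw [hφ, ← map_mul, hsymm, ← map_star, ← hDE, hstar]

theorem isMoorePenrose_pinv {V : Type*} [Fintype V] {A : Matrix V V ℝ}
    (hA : A.IsHermitian) : IsMoorePenrose A (pinv A) := by
  have h := exists_isMoorePenrose_of_isHermitian hA
  rw [pinv, dif_pos h]
  exact h.choose_spec

/-! ### The Laplacian and its potentials -/

open Classical in
/-- The Laplacian of `G` as an operator on functions. -/
noncomputable def laplacian {V : Type*} [Fintype V] (G : SimpleGraph V) (f : V → ℝ) : V → ℝ :=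
  fun x => ∑ y, if G.Adj x y then f x - f y else 0

section

variable {V : Type*} [Fintype V] {G : SimpleGraph V}

open Classical in
theorem degVec_eq_sum (x : V) : degVec G x = ∑ y, if G.Adj x y then (1 : ℝ) else 0 :=
  G.degree_eq_sum_if_adj x

open Classical in
theorem laplacian_apply (f : V → ℝ) (x : V) :
    laplacian G f x = degVec G x * f x - ∑ y, if G.Adj x y then f y else 0 := by
  rw [degVec_eq_sum, Finset.sum_mul, ← Finset.sum_sub_distrib]
  refine Finset.sum_congr rfl fun y _ => ?_
  split_ifs <;> simp

open Classical in
theorem lapMatrix_mulVec (f : V → ℝ) : G.lapMatrix ℝ *ᵥ f = laplacian G f := by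
  ext x
  rw [SimpleGraph.lapMatrix_mulVec_apply, laplacian_apply, degVec,
    ← Finset.sum_filter, SimpleGraph.neighborFinset_eq_filter]

theorem laplacian_sub (f g : V → ℝ) : laplacian G (f - g) = laplacian G f - laplacian G g := by
  classical
  simp only [← lapMatrix_mulVec, Matrix.mulVec_sub]

theorem laplacian_smul (c : ℝ) (f : V → ℝ) : laplacian G (c • f) = c • laplacian G f := by
  classical
  simp only [← lapMatrix_mulVec, Matrix.mulVec_smul]

theorem laplacian_add_const (f : V → ℝ) (c : ℝ) :
    laplacian G (fun x => f x + c) = laplacian G f := by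
  funext x
  simp [laplacian]

theorem laplacian_eq_zero_iff (hG : G.Connected) {f : V → ℝ} :
    laplacian G f = 0 ↔ ∀ i j, f i = f j := by
  classical
  rw [← lapMatrix_mulVec, SimpleGraph.lapMatrix_mulVec_eq_zero_iff_forall_reachable]
  exact ⟨fun h i j => h i j (hG i j), fun h i j _ => h i j⟩

/-- `P = 1 - L L†` is symmetric and `L P = 0`, so by connectedness its columns are constant. By
symmetry all its entries agree, hence `P` kills every `b` of zero sum. -/
theorem exists_laplacian_eq (hG : G.Connected) {b : V → ℝ} (hb : ∑ i, b i = 0) :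
    ∃ f, laplacian G f = b := by
  classical
  obtain ⟨v₀⟩ := hG.nonempty
  set L := G.lapMatrix ℝ
  obtain ⟨h₁, -, h₃, -⟩ : IsMoorePenrose L (pinv L) :=
    isMoorePenrose_pinv (G.isHermitian_lapMatrix ℝ)
  set X := pinv L
  set P := 1 - L * X
  have hLT : Lᵀ = L := (G.isSymm_lapMatrix (R := ℝ))
  have hPT : Pᵀ = P := by simp only [P, Matrix.transpose_sub, Matrix.transpose_one, h₃]
  have hPL : P * L = 0 := by simp only [P, sub_mul, one_mul, h₁, sub_self]
  have hLP : L * P = 0 := by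
    have := congrArg Matrix.transpose hPL
    rwa [Matrix.transpose_mul, hLT, hPT, Matrix.transpose_zero] at this
  have hcol : ∀ i i' j, P i j = P i' j := by
    intro i i' j
    refine (laplacian_eq_zero_iff hG (f := fun k => P k j)).1 ?_ i i'
    rw [← lapMatrix_mulVec]
    ext k
    exact congrFun (congrFun hLP k) j
  have hrow : ∀ i j, P i j = P i v₀ := by
    intro i j
    calc P i j = P v₀ j := hcol _ _ _
      _ = P j v₀ := by rw [← Matrix.transpose_apply P, hPT]
      _ = P i v₀ := hcol _ _ _
  refine ⟨X *ᵥ b, ?_⟩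
  rw [← lapMatrix_mulVec, Matrix.mulVec_mulVec]
  have hPb : P *ᵥ b = 0 := by
    ext i
    simp only [Matrix.mulVec, dotProduct, hrow i, ← Finset.mul_sum, hb, mul_zero, Pi.zero_apply]
  have : (1 - L * X) *ᵥ b = 0 := hPb
  rw [Matrix.sub_mulVec, Matrix.one_mulVec, sub_eq_zero] at this
  exact this.symm

-- For `b = L f`, symmetry of `L` gives `bᵀ L† b = fᵀ L L† L f = fᵀ L f = bᵀ f`.
open Classical in
theorem resistanceMatrix_eq_of_laplacian_eq {f : V → ℝ} {i j : V}
    (hf : laplacian G f = Pi.single i 1 - Pi.single j 1) :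
    resistanceMatrix G i j = f i - f j := by
  set L := G.lapMatrix ℝ
  obtain ⟨h₁, -, -, -⟩ : IsMoorePenrose L (pinv L) := isMoorePenrose_pinv (G.isHermitian_lapMatrix ℝ)
  have hLT : Lᵀ = L := (G.isSymm_lapMatrix (R := ℝ))
  rw [← lapMatrix_mulVec] at hf
  have key : (L *ᵥ f) ⬝ᵥ (pinv L *ᵥ (L *ᵥ f)) = (L *ᵥ f) ⬝ᵥ f := by
    conv_lhs =>
      rw [show (L *ᵥ f) = f ᵥ* L by rw [← Matrix.vecMul_transpose, hLT]]
    rw [← Matrix.dotProduct_mulVec, show f ᵥ* L = L *ᵥ f by rw [← Matrix.vecMul_transpose, hLT],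
      Matrix.mulVec_mulVec, Matrix.mulVec_mulVec, h₁]
    exact dotProduct_comm _ _
  rw [hf] at key
  simpa [resistanceMatrix, sub_dotProduct] using key

theorem degVec_pos [Nontrivial V] (hG : G.Connected) (x : V) : 0 < degVec G x := by
  classical
  exact Nat.cast_pos.2 (hG.preconnected.degree_pos_of_nontrivial x)

theorem sum_degVec : ∑ x, degVec G x = 2 * numEdges G := by
  classical
  have := G.sum_degrees_eq_twice_card_edges
  simp only [degVec, numEdges]
  rw [← Nat.cast_sum, this, ← SimpleGraph.coe_edgeFinset, Set.ncard_coe_finset]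
  push_cast; rfl

end


/-! ### Mean first passage times from the first-step equations -/

section HittingTime

variable {V : Type*} [Fintype V]

open Classical in
/-- The expectation of `f` at time `t` along the chain with transition matrix `P` killed on
hitting `j`. -/
noncomputable def killedExpectation (P : Matrix V V ℝ) (j : V) (f : V → ℝ) : ℕ → V → ℝ
  | 0, i => if i = j then 0 else f i
  | t + 1, i => if i = j then 0 else ∑ k, P i k * killedExpectation P j f t k

variable {P : Matrix V V ℝ} {j : V}

theorem killedExpectation_mono (hP : ∀ i k, 0 ≤ P i k) {f g : V → ℝ}
    (hfg : ∀ i, i ≠ j → f i ≤ g i) (t : ℕ) (i : V) :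
    killedExpectation P j f t i ≤ killedExpectation P j g t i := by
  induction t generalizing i with
  | zero =>
    simp only [killedExpectation]
    split_ifs with h
    exacts [le_rfl, hfg i h]
  | succ t ih =>
    simp only [killedExpectation]
    split_ifs with h
    · exact le_rfl
    · exact Finset.sum_le_sum fun k _ => mul_le_mul_of_nonneg_left (ih k) (hP i k)

theorem killedExpectation_const (c : ℝ) (t : ℕ) (i : V) :
    killedExpectation P j (fun _ => c) t i = c * killedExpectation P j (fun _ => 1) t i := by
  induction t generalizing i with
  | zero => simp [killedExpectation]
  | succ t ih =>
    simp only [killedExpectation, mul_ite, mul_zero, Finset.mul_sum, ih]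
    simp only [mul_left_comm]

theorem firstPassageProb_nonneg (hP : ∀ i k, 0 ≤ P i k) (t : ℕ) (i : V) :
    0 ≤ firstPassageProb P j t i := by
  induction t generalizing i with
  | zero => simp only [firstPassageProb]; split_ifs <;> norm_num
  | succ t ih =>
    simp only [firstPassageProb]
    split_ifs
    · exact le_rfl
    · exact Finset.sum_nonneg fun k _ => mul_nonneg (hP i k) (ih k)

/-- The killed expectation of `1` at time `t` is `ℙ(T > t)`. -/
theorem firstPassageProb_succ (hrow : ∀ i, i ≠ j → ∑ k, P i k = 1) (t : ℕ) (i : V) :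
    firstPassageProb P j (t + 1) i =
      killedExpectation P j (fun _ => 1) t i - killedExpectation P j (fun _ => 1) (t + 1) i := by
  induction t generalizing i with
  | zero =>
    simp only [firstPassageProb, killedExpectation]
    split_ifs with h
    · simp
    · rw [eq_sub_iff_add_eq, ← Finset.sum_add_distrib]
      refine (Finset.sum_congr rfl fun k _ => ?_).trans (hrow i h)
      split_ifs <;> simp
  | succ t ih =>
    rw [firstPassageProb, killedExpectation, killedExpectation]
    split_ifs with h
    · simp
    · rw [← Finset.sum_sub_distrib]
      exact Finset.sum_congr rfl fun k _ => by rw [ih, mul_sub]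

/-- One step costs each surviving path one unit of `h`, so the expectation drops by the survival
probability. -/
theorem killedExpectation_sub_succ {h : V → ℝ} (hj : h j = 0)
    (hh : ∀ i, i ≠ j → h i = 1 + ∑ k, P i k * h k) (t : ℕ) (i : V) :
    killedExpectation P j h t i - killedExpectation P j h (t + 1) i =
      killedExpectation P j (fun _ => 1) t i := by
  induction t generalizing i with
  | zero =>
    have h0 : ∀ k, killedExpectation P j h 0 k = h k := fun k => by
      simp only [killedExpectation]
      split_ifs with hk
      exacts [hk ▸ hj.symm, rfl]
    rw [h0, killedExpectation, killedExpectation]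
    simp only [h0]
    split_ifs with hi
    · rw [hi, hj, sub_zero]
    · rw [hh i hi]; ring
  | succ t ih =>
    rw [killedExpectation, killedExpectation, killedExpectation]
    split_ifs with hi
    · simp
    · rw [← Finset.sum_sub_distrib]
      exact Finset.sum_congr rfl fun k _ => by rw [← ih, mul_sub]

/-- Summation by parts, with the two remainders kept explicit; both vanish in the limit. -/
theorem sum_range_mul_firstPassageProb (hrow : ∀ i, i ≠ j → ∑ k, P i k = 1) {h : V → ℝ}
    (hj : h j = 0) (hh : ∀ i, i ≠ j → h i = 1 + ∑ k, P i k * h k) (i : V) (N : ℕ) :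
    ∑ t ∈ Finset.range (N + 1), (t : ℝ) * firstPassageProb P j t i =
      h i - killedExpectation P j h N i - N * killedExpectation P j (fun _ => 1) N i := by
  induction N with
  | zero =>
    simp only [killedExpectation, zero_add, Finset.sum_range_one, Nat.cast_zero, zero_mul, sub_zero]
    split_ifs with hi
    · rw [hi, hj, sub_zero]
    · rw [sub_self]
  | succ N ih =>
    rw [Finset.sum_range_succ, ih, firstPassageProb_succ hrow]
    have := killedExpectation_sub_succ hj hh N i
    push_cast
    linear_combination -this

/-- A nonnegative solution of the first-step equations gives the mean hitting times. -/
theorem meanFirstPassage_eq (hP : ∀ i k, 0 ≤ P i k) (hrow : ∀ i, i ≠ j → ∑ k, P i k = 1)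
    {h : V → ℝ} (hnn : ∀ i, 0 ≤ h i) (hj : h j = 0)
    (hh : ∀ i, i ≠ j → h i = 1 + ∑ k, P i k * h k) (i : V) :
    meanFirstPassage P i j = h i := by
  set S := killedExpectation P j fun _ => 1 with hS
  set E := killedExpectation P j h
  -- Off `j` one has `1 ≤ h ≤ M`, so `S ≤ E ≤ M * S`. Since each step lowers `E` by `S`, it shrinks
  -- `E` by at least the factor `1 - M⁻¹`: decay is geometric.
  set M : ℝ := 1 + ∑ k, h k
  have hM1 : 1 ≤ M := le_add_of_nonneg_right (Finset.sum_nonneg fun k _ => hnn k)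
  have hM0 : 0 < M := one_pos.trans_le hM1
  have hSE : ∀ t, S t i ≤ E t i := fun t => killedExpectation_mono hP (fun k hk => by
    rw [hh k hk]
    exact le_add_of_nonneg_right (Finset.sum_nonneg fun l _ => mul_nonneg (hP k l) (hnn l))) t i
  have hEM : ∀ t, E t i ≤ M * S t i := fun t => by
    rw [hS, ← killedExpectation_const]
    refine killedExpectation_mono hP (fun k _ => ?_) t i
    have := Finset.single_le_sum (fun k _ => hnn k) (Finset.mem_univ k)
    linarith
  have hS0 : ∀ t, 0 ≤ S t i := fun t => by
    have := killedExpectation_mono (j := j) hP (f := fun _ => 0) (g := fun _ => 1)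
      (fun _ _ => zero_le_one) t i
    rwa [killedExpectation_const, zero_mul] at this
  set ρ : ℝ := 1 - M⁻¹
  have hρ0 : 0 ≤ ρ := sub_nonneg.2 (inv_le_one_of_one_le₀ hM1)
  have hρ1 : ρ < 1 := sub_lt_self _ (inv_pos.2 hM0)
  have hdecay : ∀ t, E t i ≤ M * ρ ^ t := fun t => by
    induction t with
    | zero =>
      have h1 : S 0 i ≤ 1 := by
        simp only [hS, killedExpectation]; split_ifs <;> norm_num
      simpa using (hEM 0).trans (mul_le_mul_of_nonneg_left h1 hM0.le)
    | succ t ih =>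
      have h1 := killedExpectation_sub_succ hj hh t i
      have h2 : M⁻¹ * E t i ≤ S t i := by
        rw [inv_mul_le_iff₀ hM0]; exact hEM t
      have h3 : E (t + 1) i ≤ ρ * E t i := by
        change E t i - E (t + 1) i = S t i at h1
        have : ρ * E t i = E t i - M⁻¹ * E t i := by simp only [ρ]; ring
        linarith
      calc E (t + 1) i ≤ ρ * E t i := h3
        _ ≤ ρ * (M * ρ ^ t) := mul_le_mul_of_nonneg_left ih hρ0
        _ = M * ρ ^ (t + 1) := by ring
  have hElim : Filter.Tendsto (fun t => E t i) Filter.atTop (nhds 0) := by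
    refine squeeze_zero (fun t => (hS0 t).trans (hSE t)) hdecay ?_
    simpa using (tendsto_pow_atTop_nhds_zero_of_lt_one hρ0 hρ1).const_mul M
  have hSlim : Filter.Tendsto (fun t : ℕ => (t : ℝ) * S t i) Filter.atTop (nhds 0) := by
    refine squeeze_zero (g := fun t : ℕ => M * (t * ρ ^ t))
      (fun t => mul_nonneg t.cast_nonneg (hS0 t)) (fun t => ?_) ?_
    · calc (t : ℝ) * S t i ≤ t * (M * ρ ^ t) :=
            mul_le_mul_of_nonneg_left ((hSE t).trans (hdecay t)) t.cast_nonneg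
        _ = M * (t * ρ ^ t) := by ring
    · simpa using (tendsto_self_mul_const_pow_of_lt_one hρ0 hρ1).const_mul M
  refine HasSum.tsum_eq ?_
  rw [hasSum_iff_tendsto_nat_of_nonneg
    (fun t => mul_nonneg t.cast_nonneg (firstPassageProb_nonneg hP t i)),
    ← Filter.tendsto_add_atTop_iff_nat 1]
  simp only [sum_range_mul_firstPassageProb hrow hj hh]
  simpa using (tendsto_const_nhds.sub hElim).sub hSlim

end HittingTime

/-! ### The simple random walk: stationary law, commute times, Kemeny's constant -/

section RandomWalk

variable {V : Type*} [Fintype V] {G : SimpleGraph V}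

theorem walkMatrix_nonneg (i k : V) : 0 ≤ walkMatrix G i k := by
  simp only [walkMatrix]; split_ifs <;> positivity

open Classical in
theorem sum_walkMatrix_mul (f : V → ℝ) (i : V) :
    ∑ k, walkMatrix G i k * f k = (∑ k, if G.Adj i k then f k else 0) / degVec G i := by
  rw [Finset.sum_div]
  refine Finset.sum_congr rfl fun k _ => ?_
  simp only [walkMatrix, degVec]
  split_ifs
  · ring
  · simp

theorem sum_walkMatrix [Nontrivial V] (hG : G.Connected) (i : V) :
    ∑ k, walkMatrix G i k = 1 := by
  have h := sum_walkMatrix_mul (G := G) (fun _ => 1) i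
  simp only [mul_one] at h
  rw [h, ← degVec_eq_sum, div_self (degVec_pos hG i).ne']

theorem isStationary_eq [Nontrivial V] (hG : G.Connected) {p : V → ℝ}
    (hp : IsStationary (walkMatrix G) p) (i : V) :
    p i = degVec G i / (2 * numEdges G) := by
  classical
  obtain ⟨-, hsum, hinv⟩ := hp
  have hd := fun x => (degVec_pos hG x).ne'
  -- Stationarity says that `p / d` is harmonic, hence constant on a connected graph.
  have hL : laplacian G (fun x => p x / degVec G x) = 0 := by
    ext k
    rw [laplacian_apply, mul_div_cancel₀ _ (hd k), Pi.zero_apply, sub_eq_zero,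
      ← congrFun hinv k]
    simp only [Matrix.vecMul, dotProduct, walkMatrix, degVec]
    refine Finset.sum_congr rfl fun y _ => ?_
    simp only [G.adj_comm k y]
    split_ifs
    · ring
    · simp
  have hc := (laplacian_eq_zero_iff hG).1 hL
  have hpi : ∀ x, p x = p i / degVec G i * degVec G x := fun x => by
    rw [hc i x, div_mul_cancel₀ _ (hd x)]
  have h1 : p i / degVec G i * (2 * numEdges G) = 1 := by
    rw [← sum_degVec, Finset.mul_sum, ← hsum]
    exact Finset.sum_congr rfl fun x _ => (hpi x).symm
  have hm : 2 * numEdges G ≠ 0 := right_ne_zero_of_mul (h1 ▸ one_ne_zero)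
  rw [eq_div_iff hm]
  have := hd i
  field_simp at h1
  linarith

theorem isStationary_degVec [Nontrivial V] (hG : G.Connected) :
    IsStationary (walkMatrix G) fun i => degVec G i / (2 * numEdges G) := by
  classical
  have hd := degVec_pos hG
  have hm : 0 < 2 * numEdges G := by
    rw [← sum_degVec]
    exact Finset.sum_pos (fun x _ => hd x) Finset.univ_nonempty
  refine ⟨fun i => div_nonneg (hd i).le hm.le, ?_, ?_⟩
  · rw [← Finset.sum_div, sum_degVec, div_self hm.ne']
  · ext k
    simp only [Matrix.vecMul, dotProduct]
    rw [degVec_eq_sum k, Finset.sum_div]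
    refine Finset.sum_congr rfl fun y _ => ?_
    have h := (hd y).ne'
    simp only [walkMatrix, G.adj_comm k y]
    change _ * (if G.Adj y k then 1 / degVec G y else 0) = _
    split_ifs
    · field_simp
    · simp

theorem stationary_walkMatrix [Nontrivial V] (hG : G.Connected) (i : V) :
    stationary (walkMatrix G) i = degVec G i / (2 * numEdges G) := by
  have h : ∃ p, IsStationary (walkMatrix G) p := ⟨_, isStationary_degVec hG⟩
  rw [stationary, dif_pos h]
  exact isStationary_eq hG h.choose_spec i

-- Off `j` these are the first-step equations multiplied by the degree. The value at `j` is forced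
-- because a Laplacian sums to zero.
open Classical in
theorem laplacian_meanFirstPassage [Nontrivial V] (hG : G.Connected) (j : V) :
    laplacian G (fun i => meanFirstPassage (walkMatrix G) i j) =
      degVec G - (2 * numEdges G) • Pi.single j 1 := by
  have hd := degVec_pos hG
  obtain ⟨f, hf⟩ := exists_laplacian_eq hG
    (b := degVec G - (2 * numEdges G) • Pi.single j 1) (by
      simp [Finset.sum_sub_distrib, sum_degVec, Pi.single_apply])
  set h : V → ℝ := fun x => f x + -f j with hh
  have hLh : laplacian G h = degVec G - (2 * numEdges G) • Pi.single j 1 := by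
    rw [hh, laplacian_add_const, hf]
  have hoff : ∀ i, i ≠ j → laplacian G h i = degVec G i := fun i hi => by
    simp [hLh, hi]
  have hj : h j = 0 := add_neg_cancel _
  -- Minimum principle: at a minimum the Laplacian is at most `0`, but off `j` it equals a positive
  -- degree.
  have hnn : ∀ i, 0 ≤ h i := by
    obtain ⟨i₀, hi₀⟩ := Finite.exists_min h
    suffices hij : i₀ = j by
      intro i
      rw [← hj, ← hij]
      exact hi₀ i
    by_contra hne
    have h1 := hoff i₀ hne
    have h2 : laplacian G h i₀ ≤ 0 := Finset.sum_nonpos fun y _ => by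
      split_ifs
      · exact sub_nonpos.2 (hi₀ y)
      · exact le_rfl
    exact absurd (hd i₀) (not_lt.2 (h1 ▸ h2))
  have hstep : ∀ i, i ≠ j → h i = 1 + ∑ k, walkMatrix G i k * h k := fun i hi => by
    have h1 := hoff i hi
    rw [laplacian_apply] at h1
    rw [sum_walkMatrix_mul]
    have := (hd i).ne'
    field_simp
    linarith
  have : (fun i => meanFirstPassage (walkMatrix G) i j) = h := by
    ext i
    exact meanFirstPassage_eq walkMatrix_nonneg (fun i _ => sum_walkMatrix hG i) hnn hj hstep i
  rw [this, hLh]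

theorem meanFirstPassage_self (P : Matrix V V ℝ) (j : V) : meanFirstPassage P j j = 0 := by
  have : ∀ t : ℕ, (t : ℝ) * firstPassageProb P j t j = 0 := fun t => by
    cases t <;> simp [firstPassageProb]
  simp [meanFirstPassage, this]

/-- The commute time identity. -/
theorem meanFirstPassage_add_meanFirstPassage [Nontrivial V] (hG : G.Connected) (i j : V) :
    meanFirstPassage (walkMatrix G) i j + meanFirstPassage (walkMatrix G) j i =
      2 * numEdges G * resistanceMatrix G i j := by
  classical
  have hm : 2 * numEdges G ≠ 0 := by
    rw [← sum_degVec]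
    exact (Finset.sum_pos (fun x _ => degVec_pos hG x) Finset.univ_nonempty).ne'
  have hL := laplacian_sub (G := G) (fun x => meanFirstPassage (walkMatrix G) x j)
    (fun x => meanFirstPassage (walkMatrix G) x i)
  rw [laplacian_meanFirstPassage hG, laplacian_meanFirstPassage hG] at hL
  -- The degree terms cancel in the difference, leaving `2m (e_i - e_j)`; dividing by `2m` gives a
  -- unit-current potential.
  have hr := resistanceMatrix_eq_of_laplacian_eq (G := G) (i := i) (j := j)
    (f := (2 * numEdges G)⁻¹ • ((fun x => meanFirstPassage (walkMatrix G) x j) -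
      fun x => meanFirstPassage (walkMatrix G) x i)) (by
      rw [laplacian_smul, hL, sub_sub_sub_cancel_left, ← smul_sub, inv_smul_smul₀ hm])
  rw [hr]
  simp only [Pi.smul_apply, Pi.sub_apply, smul_eq_mul, meanFirstPassage_self]
  have hm' : numEdges G ≠ 0 := right_ne_zero_of_mul hm
  field_simp
  ring

theorem degVec_eq_zero [Subsingleton V] : degVec G = 0 := by
  classical
  ext x
  rw [degVec_eq_sum]
  exact Finset.sum_eq_zero fun y _ => if_neg fun h => h.ne (Subsingleton.elim _ _)

theorem numEdges_mul_kappa (hG : G.Connected) :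
    4 * numEdges G * kappa G = degVec G ⬝ᵥ (resistanceMatrix G *ᵥ degVec G) := by
  classical
  -- A side of the bridge may be a single vertex. Both sides then vanish, whatever `kappa` is.
  rcases subsingleton_or_nontrivial V with hV | hV
  · have hm := sum_degVec (G := G)
    simp only [degVec_eq_zero, Pi.zero_apply, Finset.sum_const_zero] at hm
    have hm0 : numEdges G = 0 := by linarith
    rw [degVec_eq_zero, hm0, zero_dotProduct, mul_zero, zero_mul]
  · have hm : numEdges G ≠ 0 := fun h0 => by
      have := Finset.sum_pos (fun x _ => degVec_pos hG x) Finset.univ_nonempty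
      rw [sum_degVec, h0, mul_zero] at this
      exact this.false
    set M := fun i j => meanFirstPassage (walkMatrix G) i j with hM
    set d := degVec G
    have h1 : 4 * numEdges G ^ 2 * kappa G = ∑ i, ∑ j, d i * M i j * d j := by
      simp only [kappa, kemenyConstant, Finset.mul_sum]
      refine Finset.sum_congr rfl fun i _ => ?_
      rw [Finset.sum_filter]
      refine Finset.sum_congr rfl fun j _ => ?_
      split_ifs with hij
      · rw [stationary_walkMatrix hG, stationary_walkMatrix hG]
        field_simp
        ring
      · rw [not_not.1 hij]
        simp [hM, meanFirstPassage_self]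
    have h2 : ∑ i, ∑ j, d i * M i j * d j = ∑ i, ∑ j, d i * M j i * d j := by
      rw [Finset.sum_comm]
      exact Finset.sum_congr rfl fun i _ => Finset.sum_congr rfl fun j _ => by ring
    have h3 : 2 * ∑ i, ∑ j, d i * M i j * d j =
        2 * numEdges G * (d ⬝ᵥ (resistanceMatrix G *ᵥ d)) := by
      rw [two_mul]
      nth_rw 2 [h2]
      simp only [dotProduct, Matrix.mulVec, Finset.mul_sum, ← Finset.sum_add_distrib]
      refine Finset.sum_congr rfl fun i _ => Finset.sum_congr rfl fun j _ => ?_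
      have := meanFirstPassage_add_meanFirstPassage hG i j
      linear_combination d i * d j * this
    have : numEdges G * (4 * numEdges G * kappa G) =
        numEdges G * (d ⬝ᵥ (resistanceMatrix G *ᵥ d)) := by
      linear_combination h1 + h3 / 2
    exact mul_left_cancel₀ hm this

end RandomWalk


/-! ### Gluing two graphs along an edge -/

theorem resistanceMatrix_comm {V : Type*} [Fintype V] (G : SimpleGraph V) (i j : V) :
    resistanceMatrix G i j = resistanceMatrix G j i := by
  classical
  simp only [resistanceMatrix]
  rw [← neg_sub (Pi.single j 1 : V → ℝ), Matrix.mulVec_neg, neg_dotProduct_neg]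

theorem resistanceMatrix_self {V : Type*} [Fintype V] (G : SimpleGraph V) (i : V) :
    resistanceMatrix G i i = 0 := by
  simp [resistanceMatrix]

-- The extra unit of degree sits at `u`, at resistance `0` from itself.
open Classical in
theorem sum_add_single_mul_resistanceMatrix {V : Type*} [Fintype V] (G : SimpleGraph V) (u : V) :
    ∑ x, (degVec G + (Pi.single u 1 : _ → ℝ)) x * resistanceMatrix G x u =
      ∑ x, degVec G x * resistanceMatrix G x u := by
  simp [add_mul, Finset.sum_add_distrib, Pi.single_apply, resistanceMatrix_self]

open Classical in
theorem dotProduct_resistanceMatrix_mulVec_add_single {V : Type*} [Fintype V] (G : SimpleGraph V)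
    (u : V) :
    (degVec G + (Pi.single u 1 : _ → ℝ)) ⬝ᵥ (resistanceMatrix G *ᵥ (degVec G + (Pi.single u 1 : _ → ℝ))) =
      degVec G ⬝ᵥ (resistanceMatrix G *ᵥ degVec G)
        + 2 * ∑ x, degVec G x * resistanceMatrix G x u := by
  have h₁ : degVec G ⬝ᵥ (resistanceMatrix G *ᵥ Pi.single u 1) =
      ∑ x, degVec G x * resistanceMatrix G x u := by
    rw [Matrix.mulVec_single_one]; rfl
  have h₂ : (resistanceMatrix G *ᵥ degVec G) u = ∑ x, degVec G x * resistanceMatrix G x u := by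
    simp only [Matrix.mulVec, dotProduct, resistanceMatrix_comm G u, mul_comm]
  have h₃ : (resistanceMatrix G *ᵥ Pi.single u 1) u = 0 := by
    rw [Matrix.mulVec_single_one]; exact resistanceMatrix_self G u
  rw [Matrix.mulVec_add, add_dotProduct, dotProduct_add, dotProduct_add, single_one_dotProduct,
    single_one_dotProduct, h₁, h₂, h₃]
  ring

/-- `φ` presents `G` as the disjoint union of `H` and `K` together with one edge from `v` to `w`. -/
structure IsBridgeSum {V A B : Type*} (G : SimpleGraph V) (H : SimpleGraph A) (K : SimpleGraph B)
    (v : A) (w : B) (φ : A ⊕ B ≃ V) : Prop where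
  adj_inl : ∀ a a', G.Adj (φ (.inl a)) (φ (.inl a')) ↔ H.Adj a a'
  adj_inr : ∀ b b', G.Adj (φ (.inr b)) (φ (.inr b')) ↔ K.Adj b b'
  adj_inl_inr : ∀ a b, G.Adj (φ (.inl a)) (φ (.inr b)) ↔ a = v ∧ b = w

namespace IsBridgeSum

variable {V A B : Type*} {G : SimpleGraph V} {H : SimpleGraph A} {K : SimpleGraph B}
  {v : A} {w : B} {φ : A ⊕ B ≃ V}

theorem symm (h : IsBridgeSum G H K v w φ) :
    IsBridgeSum G K H w v ((Equiv.sumComm B A).trans φ) where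
  adj_inl := h.adj_inr
  adj_inr := h.adj_inl
  adj_inl_inr b a := by
    rw [G.adj_comm]
    exact (h.adj_inl_inr a b).trans and_comm

variable [Fintype V] [Fintype A] [Fintype B]

theorem sum_eq (φ : A ⊕ B ≃ V) (f : V → ℝ) :
    ∑ x, f x = ∑ a, f (φ (.inl a)) + ∑ b, f (φ (.inr b)) := by
  rw [← φ.sum_comp, Fintype.sum_sum_type]

open Classical in
theorem degVec_inl (h : IsBridgeSum G H K v w φ) (a : A) :
    degVec G (φ (.inl a)) = degVec H a + (Pi.single v 1 : A → ℝ) a := by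
  rw [degVec_eq_sum, degVec_eq_sum, sum_eq φ]
  simp only [h.adj_inl, h.adj_inl_inr, ite_and, Pi.single_apply]
  simp

open Classical in
theorem laplacian_inl (h : IsBridgeSum G H K v w φ) (f : V → ℝ) (a : A) :
    laplacian G f (φ (.inl a)) = laplacian H (fun a => f (φ (.inl a))) a +
      if a = v then f (φ (.inl v)) - f (φ (.inr w)) else 0 := by
  rw [laplacian, sum_eq φ, laplacian]
  simp only [h.adj_inl, h.adj_inl_inr, ite_and]
  congr 1
  split_ifs with ha
  · simp [ha]
  · simp

theorem laplacian_inr (h : IsBridgeSum G H K v w φ) (f : V → ℝ) (b : B) [DecidableEq B] :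
    laplacian G f (φ (.inr b)) = laplacian K (fun b => f (φ (.inr b))) b +
      if b = w then f (φ (.inr w)) - f (φ (.inl v)) else 0 := by
  have := h.symm.laplacian_inl f b
  simp only [Equiv.trans_apply, Equiv.sumComm_apply, Sum.swap_inl, Sum.swap_inr] at this
  convert this

theorem resistanceMatrix_inl (h : IsBridgeSum G H K v w φ) (hH : H.Connected) (a a' : A) :
    resistanceMatrix G (φ (.inl a)) (φ (.inl a')) = resistanceMatrix H a a' := by
  classical
  obtain ⟨f, hf⟩ := exists_laplacian_eq hH (b := Pi.single a 1 - Pi.single a' 1) (by simp)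
  -- Constant continuation past the bridge: no current enters the other side.
  set F : V → ℝ := fun x => Sum.elim f (fun _ => f v) (φ.symm x) with hF
  have hl : ∀ a, F (φ (.inl a)) = f a := by simp [hF]
  have hr : ∀ b, F (φ (.inr b)) = f v := by simp [hF]
  rw [resistanceMatrix_eq_of_laplacian_eq hf, ← hl, ← hl]
  refine resistanceMatrix_eq_of_laplacian_eq ?_
  ext x
  obtain ⟨x | x, rfl⟩ := φ.surjective x
  · rw [h.laplacian_inl]
    simp only [hl, hr, hf, sub_self, ite_self, add_zero]
    simp [Pi.single_apply]
  · rw [h.laplacian_inr]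
    simp only [hl, hr, sub_self, ite_self, add_zero]
    simp [laplacian]

theorem resistanceMatrix_inr (h : IsBridgeSum G H K v w φ) (hK : K.Connected) (b b' : B) :
    resistanceMatrix G (φ (.inr b)) (φ (.inr b')) = resistanceMatrix K b b' :=
  h.symm.resistanceMatrix_inl hK b b'

theorem resistanceMatrix_inl_inr (h : IsBridgeSum G H K v w φ) (hH : H.Connected)
    (hK : K.Connected) (a : A) (b : B) :
    resistanceMatrix G (φ (.inl a)) (φ (.inr b)) =
      resistanceMatrix H a v + 1 + resistanceMatrix K b w := by
  classical
  obtain ⟨f, hf⟩ := exists_laplacian_eq hH (b := Pi.single a 1 - Pi.single v 1) (by simp)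
  obtain ⟨g, hg⟩ := exists_laplacian_eq hK (b := Pi.single w 1 - Pi.single b 1) (by simp)
  -- A unit current runs from `a` to `v`, over the bridge, then from `w` to `b`. The shift of `g`
  -- makes the potential drop by exactly `1` along the bridge.
  set F : V → ℝ := fun x => Sum.elim f (fun b => g b + (f v - 1 - g w)) (φ.symm x) with hF
  have hl : ∀ a, F (φ (.inl a)) = f a := by simp [hF]
  have hr : ∀ b, F (φ (.inr b)) = g b + (f v - 1 - g w) := by simp [hF]
  have hLF : laplacian G F = Pi.single (φ (.inl a)) 1 - Pi.single (φ (.inr b)) 1 := by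
    ext x
    obtain ⟨x | x, rfl⟩ := φ.surjective x
    · rw [h.laplacian_inl]
      simp only [hl, hr, hf]
      simp [Pi.single_apply]
    · rw [h.laplacian_inr]
      simp only [hl, hr, laplacian_add_const, hg]
      simp [Pi.single_apply]
      split_ifs <;> ring
  rw [resistanceMatrix_eq_of_laplacian_eq hLF, resistanceMatrix_eq_of_laplacian_eq hf,
    resistanceMatrix_comm K, resistanceMatrix_eq_of_laplacian_eq hg, hl, hr]
  ring

theorem numEdges_eq (h : IsBridgeSum G H K v w φ) :
    numEdges G = numEdges H + numEdges K + 1 := by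
  classical
  have h1 := sum_degVec (G := G)
  rw [sum_eq φ] at h1
  have h2 : ∀ b, degVec G (φ (.inr b)) = degVec K b + (Pi.single w 1 : B → ℝ) b :=
    h.symm.degVec_inl
  simp only [h.degVec_inl, h2, Finset.sum_add_distrib, sum_degVec] at h1
  simp at h1
  linarith

theorem dotProduct_resistanceMatrix_mulVec (h : IsBridgeSum G H K v w φ) (hH : H.Connected)
    (hK : K.Connected) :
    degVec G ⬝ᵥ (resistanceMatrix G *ᵥ degVec G) =
      degVec H ⬝ᵥ (resistanceMatrix H *ᵥ degVec H)
        + degVec K ⬝ᵥ (resistanceMatrix K *ᵥ degVec K)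
        + 4 * (numEdges K + 1) * (∑ a, degVec H a * resistanceMatrix H a v)
        + 4 * (numEdges H + 1) * (∑ b, degVec K b * resistanceMatrix K b w)
        + 2 * (2 * numEdges H + 1) * (2 * numEdges K + 1) := by
  classical
  have hl : ∀ a, degVec G (φ (.inl a)) = (degVec H + (Pi.single v 1 : _ → ℝ)) a := h.degVec_inl
  have hr : ∀ b, degVec G (φ (.inr b)) = (degVec K + (Pi.single w 1 : _ → ℝ)) b := h.symm.degVec_inl
  have hrl : ∀ b a, resistanceMatrix G (φ (.inr b)) (φ (.inl a)) =
      resistanceMatrix H a v + 1 + resistanceMatrix K b w := fun b a => by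
    rw [resistanceMatrix_comm, h.resistanceMatrix_inl_inr hH hK]
  have eH := dotProduct_resistanceMatrix_mulVec_add_single H v
  have eK := dotProduct_resistanceMatrix_mulVec_add_single K w
  have rH := sum_add_single_mul_resistanceMatrix H v
  have rK := sum_add_single_mul_resistanceMatrix K w
  have sH : ∑ a, (degVec H + (Pi.single v 1 : _ → ℝ)) a = 2 * numEdges H + 1 := by
    simp [Finset.sum_add_distrib, sum_degVec]
  have sK : ∑ b, (degVec K + (Pi.single w 1 : _ → ℝ)) b = 2 * numEdges K + 1 := by
    simp [Finset.sum_add_distrib, sum_degVec]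
  simp only [dotProduct, Matrix.mulVec, sum_eq φ, hl, hr, h.resistanceMatrix_inl hH,
    h.resistanceMatrix_inr hK, h.resistanceMatrix_inl_inr hH hK, hrl] at eH eK ⊢
  -- Only the totals of `p` and `q` (`sH`, `sK`), their pairings with the resistances to the bridge
  -- ends (`rH`, `rK`) and their quadratic forms (`eH`, `eK`) are needed from here.
  generalize degVec H + (Pi.single v 1 : _ → ℝ) = p at *
  generalize degVec K + (Pi.single w 1 : _ → ℝ) = q at *
  have c₁ : ∀ a, ∑ b, (resistanceMatrix H a v + 1 + resistanceMatrix K b w) * q b =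
      (resistanceMatrix H a v + 1) * (2 * numEdges K + 1)
        + ∑ b, degVec K b * resistanceMatrix K b w := fun a => by
    rw [← sK, ← rK, Finset.mul_sum, ← Finset.sum_add_distrib]
    exact Finset.sum_congr rfl fun b _ => by ring
  have c₂ : ∀ b, ∑ a, (resistanceMatrix H a v + 1 + resistanceMatrix K b w) * p a =
      (resistanceMatrix K b w + 1) * (2 * numEdges H + 1)
        + ∑ a, degVec H a * resistanceMatrix H a v := fun b => by
    rw [← sH, ← rH, Finset.mul_sum, ← Finset.sum_add_distrib]
    exact Finset.sum_congr rfl fun a _ => by ring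
  have d₁ : ∑ a, p a * ∑ b, (resistanceMatrix H a v + 1 + resistanceMatrix K b w) * q b =
      ((∑ a, degVec H a * resistanceMatrix H a v) + (2 * numEdges H + 1)) * (2 * numEdges K + 1)
        + (2 * numEdges H + 1) * ∑ b, degVec K b * resistanceMatrix K b w := by
    rw [← sH, ← rH, ← Finset.sum_add_distrib, Finset.sum_mul, Finset.sum_mul,
      ← Finset.sum_add_distrib]
    exact Finset.sum_congr rfl fun a _ => by rw [c₁]; ring
  have d₂ : ∑ b, q b * ∑ a, (resistanceMatrix H a v + 1 + resistanceMatrix K b w) * p a =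
      ((∑ b, degVec K b * resistanceMatrix K b w) + (2 * numEdges K + 1)) * (2 * numEdges H + 1)
        + (2 * numEdges K + 1) * ∑ a, degVec H a * resistanceMatrix H a v := by
    rw [← sK, ← rK, ← Finset.sum_add_distrib, Finset.sum_mul, Finset.sum_mul,
      ← Finset.sum_add_distrib]
    exact Finset.sum_congr rfl fun b _ => by rw [c₂]; ring
  simp only [mul_add (p _), mul_add (q _), Finset.sum_add_distrib, d₁, d₂, eH, eK]
  ring

theorem kappa_eq (h : IsBridgeSum G H K v w φ) (hG : G.Connected) (hH : H.Connected)
    (hK : K.Connected) :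
    kappa G = numEdges H / numEdges G * kappa H + numEdges K / numEdges G * kappa K
      + (numEdges K + 1) / numEdges G * (∑ a, degVec H a * resistanceMatrix H a v)
      + (numEdges H + 1) / numEdges G * (∑ b, degVec K b * resistanceMatrix K b w)
      + (2 * numEdges H + 1) * (2 * numEdges K + 1) / (2 * numEdges G) := by
  have hpos : 0 < numEdges G := by
    rw [h.numEdges_eq]
    simp only [numEdges]
    positivity
  have key := h.dotProduct_resistanceMatrix_mulVec hH hK
  rw [← numEdges_mul_kappa hG, ← numEdges_mul_kappa hH, ← numEdges_mul_kappa hK] at key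
  field_simp
  linarith

end IsBridgeSum

/-! ### The two components left by deleting a bridge -/

/-- Follow a walk from `x` to `v` until it first meets the deleted edge: it is then at `v` or `w`.
-/
theorem reachable_deleteEdges_or {V : Type*} {G : SimpleGraph V} (hG : G.Connected) (v w x : V) :
    (G.deleteEdges {s(v, w)}).Reachable x v ∨ (G.deleteEdges {s(v, w)}).Reachable x w := by
  obtain ⟨p⟩ := hG x v
  induction p with
  | nil => exact .inl .rfl
  | @cons a b c hab _ ih =>
    by_cases he : s(a, b) = s(c, w)
    · rcases Sym2.eq_iff.1 he with ⟨rfl, -⟩ | ⟨rfl, -⟩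
      · exact .inl .rfl
      · exact .inr .rfl
    · have : (G.deleteEdges {s(c, w)}).Adj a b := SimpleGraph.deleteEdges_adj.2 ⟨hab, he⟩
      exact ih.imp this.reachable.trans this.reachable.trans

theorem exists_isBridgeSum {V : Type*} {G : SimpleGraph V} (hG : G.Connected) {v w : V}
    (hadj : G.Adj v w) (hbridge : G.IsBridge s(v, w))
    {C D : (G.deleteEdges {s(v, w)}).ConnectedComponent} (hv : v ∈ C) (hw : w ∈ D) :
    ∃ φ : C ⊕ D ≃ V, IsBridgeSum G C.toSimpleGraph D.toSimpleGraph ⟨v, hv⟩ ⟨w, hw⟩ φ := by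
  -- A common vertex would join `v` to `w` without the bridge.
  have hCD : ∀ x, x ∈ C → x ∉ D := fun x hC hD =>
    SimpleGraph.isBridge_iff.1 hbridge <|
      (C.reachable_of_mem_supp hv hC).trans (D.reachable_of_mem_supp hD hw)
  have hbij : Function.Bijective (Sum.elim Subtype.val Subtype.val : C ⊕ D → V) := by
    refine ⟨Subtype.val_injective.sumElim Subtype.val_injective fun a b hab =>
      hCD a a.2 (hab ▸ b.2), fun x => ?_⟩
    rcases reachable_deleteEdges_or hG v w x with h | h
    · exact ⟨.inl ⟨x, (SimpleGraph.ConnectedComponent.sound h).trans hv⟩, rfl⟩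
    · exact ⟨.inr ⟨x, (SimpleGraph.ConnectedComponent.sound h).trans hw⟩, rfl⟩
  refine ⟨Equiv.ofBijective _ hbij, ?_, ?_, ?_⟩
  · rintro ⟨a, ha⟩ ⟨a', ha'⟩
    rw [SimpleGraph.ConnectedComponent.toSimpleGraph_adj, SimpleGraph.deleteEdges_adj]
    refine ⟨fun h => ⟨h, fun he => ?_⟩, And.left⟩
    rcases Sym2.eq_iff.1 he with ⟨-, rfl⟩ | ⟨rfl, -⟩
    exacts [hCD _ ha' hw, hCD _ ha hw]
  · rintro ⟨b, hb⟩ ⟨b', hb'⟩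
    rw [SimpleGraph.ConnectedComponent.toSimpleGraph_adj, SimpleGraph.deleteEdges_adj]
    refine ⟨fun h => ⟨h, fun he => ?_⟩, And.left⟩
    rcases Sym2.eq_iff.1 he with ⟨rfl, -⟩ | ⟨-, rfl⟩
    exacts [hCD _ hv hb, hCD _ hv hb']
  · rintro ⟨a, ha⟩ ⟨b, hb⟩
    rw [Subtype.mk.injEq, Subtype.mk.injEq]
    constructor
    · intro h
      by_cases he : s(a, b) = s(v, w)
      · rcases Sym2.eq_iff.1 he with h | ⟨rfl, -⟩
        exacts [h, (hCD _ ha hw).elim]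
      · exact (hCD b (C.mem_supp_of_adj_mem_supp ha
          (SimpleGraph.deleteEdges_adj.2 ⟨h, he⟩)) hb).elim
    · rintro ⟨rfl, rfl⟩
      exact hadj

end KemenyBridge

theorem proposition2p2 {V : Type*} [Fintype V] [DecidableEq V]
    (G : SimpleGraph V) (hG : G.Connected)
    (v₁ v₂ : V) (hadj : G.Adj v₁ v₂) (hbridge : G.IsBridge s(v₁, v₂))
    (C₁ C₂ : (G.deleteEdges {s(v₁, v₂)}).ConnectedComponent)
    (h₁ : v₁ ∈ C₁) (h₂ : v₂ ∈ C₂) [Fintype C₁] [Fintype C₂] :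
    KemenyBridge.kappa G =
      KemenyBridge.numEdges C₁.toSimpleGraph / KemenyBridge.numEdges G
          * KemenyBridge.kappa C₁.toSimpleGraph
        + KemenyBridge.numEdges C₂.toSimpleGraph / KemenyBridge.numEdges G
          * KemenyBridge.kappa C₂.toSimpleGraph
        + (KemenyBridge.numEdges C₂.toSimpleGraph + 1) / KemenyBridge.numEdges G
          * (KemenyBridge.degVec C₁.toSimpleGraph ⬝ᵥ
              (KemenyBridge.resistanceMatrix C₁.toSimpleGraph *ᵥ Pi.single ⟨v₁, h₁⟩ 1))
        + (KemenyBridge.numEdges C₁.toSimpleGraph + 1) / KemenyBridge.numEdges G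
          * (KemenyBridge.degVec C₂.toSimpleGraph ⬝ᵥ
              (KemenyBridge.resistanceMatrix C₂.toSimpleGraph *ᵥ Pi.single ⟨v₂, h₂⟩ 1))
        + (2 * KemenyBridge.numEdges C₁.toSimpleGraph + 1)
            * (2 * KemenyBridge.numEdges C₂.toSimpleGraph + 1)
          / (2 * KemenyBridge.numEdges G) := by

  obtain ⟨φ, h⟩ := KemenyBridge.exists_isBridgeSum hG hadj hbridge h₁ h₂
  rw [Matrix.mulVec_single_one, Matrix.mulVec_single_one]
  exact h.kappa_eq hG C₁.connected_toSimpleGraph C₂.connected_toSimpleGraph
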